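/- Let $n\ge 5$ be an integer, let $T>0$, and let $v\in C^4(\mathbb{R})$ be a positive $2T$-periodic solution of $$v''''-\frac{n^2-4n+8}{2}\,v''+\frac{n^2(n-4)^2}{16}\,v=v^{\frac{n+4}{n-4}}\qquad\text{in }\mathbb{R}.$$ Let $u(x)=|x|^{-\frac{n-4}{2}}\,v(\log|x|)$ for $x\in\mathbb{R}^n\setminus\{0\}$. Then $$-\Delta u\;\ge\;\sqrt{\frac{n(n-4)}{n^2-4}}\;u^{\frac{n}{n-4}}+\frac{2}{n-4}\,\frac{|\nabla u|^2}{u}\qquad\text{at every point of }\mathbb{R}^n\setminus\{0\}.$$ Moreover, the scalar curvature of the conformal metric $g=u^{\frac{4}{n-4}}\,|dx|^2$ is positive at every point of $\mathbb{R}^n\setminus\{0\}$. -/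

import Mathlib

open scoped Gradient Laplacian

noncomputable section

namespace Delaunay

/-- The coefficient of `v''` in the fourth order equation for `v`. -/
def K₂ (n : ℕ) : ℝ := -((n : ℝ) ^ 2 - 4 * n + 8) / 2

/-- The coefficient of `v` in the fourth order equation for `v`. -/
def K₀ (n : ℕ) : ℝ := (n : ℝ) ^ 2 * ((n : ℝ) - 4) ^ 2 / 16

/-- `v` is a positive `2T`-periodic solution, of class `C⁴` on the real line, of
`v'''' + K₂ v'' + K₀ v = v ^ ((n + 4) / (n - 4))`. The number `2T` is a period and need not be the
least one. -/
structure IsPositivePeriodicSolution (n : ℕ) (T : ℝ) (v : ℝ → ℝ) : Prop where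
  contDiff : ContDiff ℝ 4 v
  pos : ∀ t, 0 < v t
  periodic : Function.Periodic v (2 * T)
  equation : ∀ t, iteratedDeriv 4 v t + K₂ n * iteratedDeriv 2 v t + K₀ n * v t
    = v t ^ (((n : ℝ) + 4) / ((n : ℝ) - 4))

/-- The radial function `u(x) = |x| ^ (-(n - 4) / 2) * v (log |x|)`, so that
`v(t) = r ^ ((n - 4) / 2) * u(r)` with `r = e ^ t`. Only its values away from the origin matter. -/
def singularSolution (n : ℕ) (v : ℝ → ℝ) (x : EuclideanSpace ℝ (Fin n)) : ℝ :=
  ‖x‖ ^ (-((n : ℝ) - 4) / 2) * v (Real.log ‖x‖)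

/-- The partial derivative `∂ᵢ f` in the standard coordinates. -/
def partialDeriv {n : ℕ} (i : Fin n) (f : EuclideanSpace ℝ (Fin n) → ℝ)
    (x : EuclideanSpace ℝ (Fin n)) : ℝ :=
  fderiv ℝ f x (EuclideanSpace.single i 1)

/-- The Christoffel symbol `Γᵏᵢⱼ = ½ ∑ₗ gᵏˡ (∂ᵢ gⱼₗ + ∂ⱼ gᵢₗ - ∂ₗ gᵢⱼ)` of a metric `g`, given by
its matrix `(gᵢⱼ)` in the standard coordinates. -/
def christoffel {n : ℕ} (g : EuclideanSpace ℝ (Fin n) → Matrix (Fin n) (Fin n) ℝ)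
    (k i j : Fin n) (x : EuclideanSpace ℝ (Fin n)) : ℝ :=
  (1 / 2) * ∑ l, (g x)⁻¹ k l *
    (partialDeriv i (fun y => g y j l) x + partialDeriv j (fun y => g y i l) x
      - partialDeriv l (fun y => g y i j) x)

/-- The Ricci curvature
`Rᵢⱼ = ∑ₖ (∂ₖ Γᵏᵢⱼ - ∂ⱼ Γᵏᵢₖ) + ∑ₖ ∑ₗ (Γᵏₖₗ Γˡᵢⱼ - Γᵏⱼₗ Γˡᵢₖ)` of a metric in coordinates. -/
def ricci {n : ℕ} (g : EuclideanSpace ℝ (Fin n) → Matrix (Fin n) (Fin n) ℝ)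
    (i j : Fin n) (x : EuclideanSpace ℝ (Fin n)) : ℝ :=
  ∑ k, (partialDeriv k (christoffel g k i j) x - partialDeriv j (christoffel g k i k) x)
    + ∑ k, ∑ l, (christoffel g k k l x * christoffel g l i j x
      - christoffel g k j l x * christoffel g l i k x)

/-- The scalar curvature `R = ∑ᵢ ∑ⱼ gⁱʲ Rᵢⱼ` of a metric in coordinates. -/
def scalarCurvature {n : ℕ} (g : EuclideanSpace ℝ (Fin n) → Matrix (Fin n) (Fin n) ℝ)
    (x : EuclideanSpace ℝ (Fin n)) : ℝ :=
  ∑ i, ∑ j, (g x)⁻¹ i j * ricci g i j x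

/-- The conformal metric `u ^ (4 / (n - 4)) |dx|²` as a matrix in the standard coordinates. -/
def conformalMetric {n : ℕ} (u : EuclideanSpace ℝ (Fin n) → ℝ)
    (x : EuclideanSpace ℝ (Fin n)) : Matrix (Fin n) (Fin n) ℝ :=
  (u x ^ (4 / ((n : ℝ) - 4))) • (1 : Matrix (Fin n) (Fin n) ℝ)

end Delaunay

end

/-!
Write `n = 2 m + 4` and `t = log |x|`. The metric `g = u ^ (4 / (n - 4)) |dx|²` equals
`v ^ (2 / m) (dt² + dσ²)` on the cylinder, and its scalar curvature is `2 (n - 1) S` with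
`S = (m + 1 - a² - v'' / (m v)) v ^ (-2 / m)` and `a = v' / (m v)`, a periodic function of `t`
(`scalarCurvature_conformalMetric`). The difference of the two sides of the pointwise inequality is
`(m S - c) u ^ (n / (n - 4))`, with `c` the square root in the statement (`neg_laplacian_sub_eq`).
So both claims are about the minimum of `S` over a period.

The equation for `v` says that `g` has constant positive `Q`-curvature. The `Q`-curvature is a
combination of the Laplacian of the scalar curvature, its square, and minus the squared norm of the
traceless Ricci tensor. At a minimum of `S` the Laplacian term has a sign, which leaves a bound of
the `Q`-curvature by a multiple of `S²` (`paneitz_le_of_isLocalMin`; there the computation is done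
in the one variable `t`). It yields `c² ≤ (m S)²` at the minimum.

This does not exclude a negative minimum. Positivity of `S` comes from deforming `v` linearly to
the constant function `1`, whose metric is the round cylinder: the fourth order operator is linear,
so it stays positive along the deformation, and by the same bound the minimum of `S` can never be
`0` (`cylScal_pos`).
-/

namespace Delaunay

/-! ### The scalar curvature of `v ^ (4 / (n - 4)) (dt² + dσ²)` along the cylinder -/

/-- Up to the positive factor `2 (n - 1) v ^ (-4 / (n - 4))`, the scalar curvature of the metric
`v ^ (4 / (n - 4)) (dt² + dσ²)` on the cylinder, as a function of the values `v₀, v₁, v₂` of `v` and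
its first two derivatives; here `m = (n - 4) / 2`. -/
noncomputable def cylScal (m v₀ v₁ v₂ : ℝ) : ℝ := m + 1 - (v₁ / (m * v₀)) ^ 2 - v₂ / v₀ / m

theorem _root_.IsLocalMin.second_deriv_nonneg {f f₁ f₂ : ℝ → ℝ} {t : ℝ}
    (h₁ : ∀ t, HasDerivAt f (f₁ t) t) (h₂ : ∀ t, HasDerivAt f₁ (f₂ t) t) (hmin : IsLocalMin f t) :
    f₁ t = 0 ∧ 0 ≤ f₂ t := by
  have h0 : f₁ t = 0 := hmin.hasDerivAt_eq_zero (h₁ t)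
  refine ⟨h0, ?_⟩
  by_contra! hneg
  have e1 : deriv f = f₁ := funext fun t => (h₁ t).deriv
  have e2 : deriv f₁ = f₂ := funext fun t => (h₂ t).deriv
  have hmax : IsLocalMax f t :=
    isLocalMax_of_deriv_deriv_neg (by rwa [e1, e2]) (by rwa [e1]) (h₁ t).continuousAt
  -- A point that is both a local minimum and a local maximum makes `f` locally constant.
  have hc : f =ᶠ[nhds t] fun _ => f t := by
    filter_upwards [hmin, hmax] with y hy hy' using le_antisymm hy' hy
  have hc1 : f₁ =ᶠ[nhds t] fun _ => 0 := by
    simpa [e1] using hc.deriv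
  have := hc1.deriv_eq
  simp only [e2, deriv_const'] at this
  linarith

variable {m : ℝ} {v v₁ v₂ v₃ v₄ : ℝ → ℝ}

/-- The pointwise form of the formula for the `Q`-curvature. At a minimum of the scalar curvature
the term with its Laplacian has a sign, and so does the traceless Ricci term, whose square
`(1 + a' - a²)²` with `a = v' / (m v)` is dropped. -/
theorem paneitz_le_of_isLocalMin (hm : 0 < m) (hv : ∀ t, 0 < v t)
    (h₁ : ∀ t, HasDerivAt v (v₁ t) t) (h₂ : ∀ t, HasDerivAt v₁ (v₂ t) t)
    (h₃ : ∀ t, HasDerivAt v₂ (v₃ t) t) (h₄ : ∀ t, HasDerivAt v₃ (v₄ t) t) {t : ℝ}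
    (hmin : IsLocalMin (fun t => cylScal m (v t) (v₁ t) (v₂ t) * v t ^ (-(2 / m))) t) :
    v₄ t - (2 * m ^ 2 + 4 * m + 4) * v₂ t + m ^ 2 * (m + 2) ^ 2 * v t
      ≤ m * (m + 1) * (m + 3) / (m + 2) * cylScal m (v t) (v₁ t) (v₂ t) ^ 2 * v t := by
  have hm0 := hm.ne'
  have hv0 : ∀ t, v t ≠ 0 := fun t => (hv t).ne'
  set a : ℝ → ℝ := fun t => v₁ t / (m * v t) with ha
  set p : ℝ → ℝ := fun t => v₂ t / v t with hp
  set q : ℝ → ℝ := fun t => v₃ t / v t with hq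
  set r : ℝ → ℝ := fun t => v₄ t / v t with hr
  set w : ℝ → ℝ := fun t => v t ^ (-(2 / m)) with hw
  have hwpos : ∀ t, 0 < w t := fun t => Real.rpow_pos_of_pos (hv t) _
  have da : ∀ t, HasDerivAt a (p t / m - m * a t ^ 2) t := fun t => by
    refine ((h₂ t).div ((h₁ t).const_mul m) (mul_ne_zero hm0 (hv0 t))).congr_deriv ?_
    have := hv0 t
    simp only [ha, hp]; field_simp
  have dp : ∀ t, HasDerivAt p (q t - m * a t * p t) t := fun t => by
    refine ((h₃ t).div (h₁ t) (hv0 t)).congr_deriv ?_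
    have := hv0 t
    simp only [ha, hp, hq]; field_simp
  have dq : ∀ t, HasDerivAt q (r t - m * a t * q t) t := fun t => by
    refine ((h₄ t).div (h₁ t) (hv0 t)).congr_deriv ?_
    have := hv0 t
    simp only [ha, hr, hq]; field_simp
  have dw : ∀ t, HasDerivAt w (-2 * a t * w t) t := fun t => by
    refine ((h₁ t).rpow_const (Or.inl (hv0 t))).congr_deriv ?_
    have := hv0 t
    simp only [ha, hw]
    rw [Real.rpow_sub_one (hv0 t)]
    field_simp
  set s : ℝ → ℝ := fun t => m + 1 - a t ^ 2 - p t / m with hs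
  set s₁ : ℝ → ℝ := fun t => -2 * a t * (p t / m - m * a t ^ 2) - (q t - m * a t * p t) / m with hs1
  set s₂ : ℝ → ℝ := fun t => -2 * (p t / m - m * a t ^ 2) ^ 2
    - 2 * a t * ((q t - m * a t * p t) / m - 2 * m * a t * (p t / m - m * a t ^ 2))
    - ((r t - m * a t * q t) - m * ((p t / m - m * a t ^ 2) * p t
      + a t * (q t - m * a t * p t))) / m with hs2
  have ds : ∀ t, HasDerivAt s (s₁ t) t := fun t => by
    refine (((da t).pow 2).const_sub (m + 1) |>.sub ((dp t).div_const m)).congr_deriv ?_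
    simp only [hs1]; push_cast; ring
  have ds1 : ∀ t, HasDerivAt s₁ (s₂ t) t := fun t => by
    refine ((((da t).const_mul (-2)).mul (((dp t).div_const m).sub
      (((da t).pow 2).const_mul m))).sub
      (((dq t).sub (((da t).const_mul m).mul (dp t))).div_const m)).congr_deriv ?_
    simp only [hs2, Pi.sub_apply, Pi.pow_apply]; push_cast; ring
  have dS : ∀ t, HasDerivAt (fun t => s t * w t) ((s₁ t - 2 * a t * s t) * w t) t := fun t => by
    refine ((ds t).mul (dw t)).congr_deriv ?_
    ring
  have dS1 : ∀ t, HasDerivAt (fun t => (s₁ t - 2 * a t * s t) * w t)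
      ((s₂ t - 2 * (p t / m - m * a t ^ 2) * s t - 4 * a t * s₁ t + 4 * a t ^ 2 * s t) * w t) t :=
    fun t => by
    refine (((ds1 t).sub (((da t).const_mul 2).mul (ds t))).mul (dw t)).congr_deriv ?_
    simp only [Pi.sub_apply, Pi.mul_apply]
    ring
  obtain ⟨e1, e2⟩ := IsLocalMin.second_deriv_nonneg dS dS1 hmin
  have x1 : s₁ t - 2 * a t * s t = 0 := (mul_eq_zero.1 e1).resolve_right (hwpos t).ne'
  have x2 := nonneg_of_mul_nonneg_left e2 (hwpos t)
  have key : r t - (2 * m ^ 2 + 4 * m + 4) * p t + m ^ 2 * (m + 2) ^ 2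
      = m * (m + 1) * (m + 3) / (m + 2) * s t ^ 2
        - m * (s₂ t - 2 * (p t / m - m * a t ^ 2) * s t - 4 * a t * s₁ t + 4 * a t ^ 2 * s t)
        - m * (2 * m + 3) / (m + 2) * (1 + (p t / m - m * a t ^ 2) - a t ^ 2) ^ 2
        - 2 * m * (m + 1) * a t * (s₁ t - 2 * a t * s t) := by
    have : m + 2 ≠ 0 := by positivity
    simp only [hs, hs1, hs2]
    field_simp
    ring
  have hle : r t - (2 * m ^ 2 + 4 * m + 4) * p t + m ^ 2 * (m + 2) ^ 2
      ≤ m * (m + 1) * (m + 3) / (m + 2) * s t ^ 2 := by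
    rw [key, x1]
    have := mul_nonneg hm.le x2
    have h3 : 0 ≤ m * (2 * m + 3) / (m + 2) * (1 + (p t / m - m * a t ^ 2) - a t ^ 2) ^ 2 := by
      positivity
    linarith
  have h4 := mul_le_mul_of_nonneg_right hle (hv t).le
  have hvt := hv0 t
  calc _ = (r t - (2 * m ^ 2 + 4 * m + 4) * p t + m ^ 2 * (m + 2) ^ 2) * v t := by
        simp only [hr, hp]; field_simp
    _ ≤ _ := h4

/-! ### Positivity and the sharp lower bound of the scalar curvature -/

theorem _root_.Function.Periodic.exists_forall_le {f : ℝ → ℝ} {c : ℝ} (hf : Function.Periodic f c)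
    (hc : 0 < c) (hcont : Continuous f) : ∃ t, ∀ s, f t ≤ f s := by
  obtain ⟨t, -, ht⟩ := (isCompact_Icc (a := (0 : ℝ)) (b := c)).exists_isMinOn
    ⟨0, Set.left_mem_Icc.2 hc.le⟩ hcont.continuousOn
  refine ⟨t, fun s => ?_⟩
  obtain ⟨y, hy, hys⟩ := hf.exists_mem_Ico₀ hc s
  rw [hys]
  exact ht ⟨hy.1, hy.2.le⟩

variable {c : ℝ}

theorem cylScal_eq_div (hm : m ≠ 0) {x y z : ℝ} (hx : x ≠ 0) :
    cylScal m x y z = ((m + 1) * m ^ 2 * x ^ 2 - y ^ 2 - m * x * z) / (m ^ 2 * x ^ 2) := by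
  unfold cylScal
  field_simp

/-- If the `Q`-curvature is positive, then so is the scalar curvature. Along the path
`(1 - l) v + l` from `v` to the round cylinder the `Q`-curvature stays positive; if the scalar
curvature were nonpositive somewhere on the path, then at the parameter nearest to the cylinder
where this happens it would be nonnegative with a zero, contradicting
`paneitz_le_of_isLocalMin` there. -/
theorem cylScal_pos (hm : 0 < m) (hc : 0 < c) (hv : ∀ t, 0 < v t)
    (h₁ : ∀ t, HasDerivAt v (v₁ t) t) (h₂ : ∀ t, HasDerivAt v₁ (v₂ t) t)
    (h₃ : ∀ t, HasDerivAt v₂ (v₃ t) t) (h₄ : ∀ t, HasDerivAt v₃ (v₄ t) t)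
    (p₀ : Function.Periodic v c) (p₁ : Function.Periodic v₁ c) (p₂ : Function.Periodic v₂ c)
    (hP : ∀ t, 0 < v₄ t - (2 * m ^ 2 + 4 * m + 4) * v₂ t + m ^ 2 * (m + 2) ^ 2 * v t) (t : ℝ) :
    0 < cylScal m (v t) (v₁ t) (v₂ t) := by
  have c₀ : Continuous v := continuous_iff_continuousAt.2 fun t => (h₁ t).continuousAt
  have c₁ : Continuous v₁ := continuous_iff_continuousAt.2 fun t => (h₂ t).continuousAt
  have c₂ : Continuous v₂ := continuous_iff_continuousAt.2 fun t => (h₃ t).continuousAt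
  -- The numerator of the scalar curvature along the path; it is continuous for all parameters.
  set G : ℝ × ℝ → ℝ := fun z =>
    (m + 1) * m ^ 2 * ((1 - z.1) * v z.2 + z.1) ^ 2 - ((1 - z.1) * v₁ z.2) ^ 2
      - m * ((1 - z.1) * v z.2 + z.1) * ((1 - z.1) * v₂ z.2) with hG
  have cG : Continuous G := by fun_prop
  have pG : ∀ l, Function.Periodic (fun t => G (l, t)) c := fun l t => by
    simp only [hG, p₀ t, p₁ t, p₂ t]
  have hV : ∀ l ∈ Set.Icc (0 : ℝ) 1, ∀ t, 0 < (1 - l) * v t + l := fun l hl t => by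
    rcases hl.1.eq_or_lt with rfl | h
    · simpa using hv t
    · have := mul_nonneg (sub_nonneg.2 hl.2) (hv t).le
      linarith
  have hsign : ∀ l ∈ Set.Icc (0 : ℝ) 1, ∀ t, cylScal m ((1 - l) * v t + l) ((1 - l) * v₁ t)
      ((1 - l) * v₂ t) = G (l, t) / (m ^ 2 * ((1 - l) * v t + l) ^ 2) := fun l hl t =>
    cylScal_eq_div hm.ne' (hV l hl t).ne'
  set K : Set (ℝ × ℝ) := (Set.Icc (0 : ℝ) 1 ×ˢ Set.Icc (0 : ℝ) c) ∩ {z | G z ≤ 0} with hK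
  have hKc : IsCompact K :=
    (isCompact_Icc.prod isCompact_Icc).inter_right (isClosed_le cG continuous_const)
  suffices hKe : K = ∅ by
    obtain ⟨y, hy, hys⟩ := (pG 0).exists_mem_Ico₀ hc t
    have h0 : (0 : ℝ) ∈ Set.Icc (0 : ℝ) 1 := ⟨le_rfl, zero_le_one⟩
    have hpos : 0 < G (0, y) := by
      by_contra! hle
      have : ((0 : ℝ), y) ∈ K := ⟨⟨h0, hy.1, hy.2.le⟩, hle⟩
      simp [hKe] at this
    have := hsign 0 h0 t
    simp only [sub_zero, one_mul, add_zero] at this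
    rw [this]
    have hvt := hv t
    rw [← hys] at hpos
    exact div_pos hpos (by positivity)
  by_contra! hne
  obtain ⟨⟨l, t₀⟩, ⟨⟨hl, ht₀⟩, hle⟩, hmax⟩ := hKc.exists_isMaxOn hne continuous_fst.continuousOn
  simp only at hl ht₀
  have hl1 : l < 1 := by
    refine lt_of_le_of_ne hl.2 ?_
    rintro rfl
    have : G (1, t₀) = (m + 1) * m ^ 2 := by simp [hG]
    simp only [Set.mem_ofPred_eq, this] at hle
    have : 0 < (m + 1) * m ^ 2 := by positivity
    linarith
  have hGnn : ∀ t, 0 ≤ G (l, t) := by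
    intro t
    by_contra! hlt
    obtain ⟨y, hy, hys⟩ := (pG l).exists_mem_Ico₀ hc t
    rw [hys] at hlt
    have hev : ∀ᶠ l' in nhds l, G (l', y) < 0 :=
      (cG.comp (continuous_id.prodMk continuous_const)).continuousAt.eventually_lt
        continuousAt_const hlt
    obtain ⟨l', hl', h1, h2⟩ :=
      ((hev.filter_mono nhdsWithin_le_nhds).and (Ioo_mem_nhdsGT hl1)).exists
    have : l' ≤ l := hmax (a := (l', y)) ⟨⟨⟨hl.1.trans h1.le, h2.le⟩, hy.1, hy.2.le⟩, hl'.le⟩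
    exact absurd h1 (not_lt.2 this)
  have hz : cylScal m ((1 - l) * v t₀ + l) ((1 - l) * v₁ t₀) ((1 - l) * v₂ t₀) = 0 := by
    rw [hsign l hl, le_antisymm hle (hGnn t₀), zero_div]
  have hmin : IsLocalMin (fun t => cylScal m ((1 - l) * v t + l) ((1 - l) * v₁ t)
      ((1 - l) * v₂ t) * ((1 - l) * v t + l) ^ (-(2 / m))) t₀ := by
    refine Filter.Eventually.of_forall fun t => ?_
    simp only [hz, zero_mul]
    rw [hsign l hl]
    have := hV l hl t
    exact mul_nonneg (div_nonneg (hGnn t) (by positivity)) (Real.rpow_nonneg this.le _)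
  have := paneitz_le_of_isLocalMin hm (hV l hl) (fun t => ((h₁ t).const_mul (1 - l)).add_const l)
    (fun t => (h₂ t).const_mul (1 - l)) (fun t => (h₃ t).const_mul (1 - l))
    (fun t => (h₄ t).const_mul (1 - l)) hmin
  rw [hz] at this
  have h5 := mul_pos (sub_pos.2 hl1) (hP t₀)
  have h6 : 0 ≤ l * (m ^ 2 * (m + 2) ^ 2) := mul_nonneg hl.1 (by positivity)
  linarith

/-- The sharp lower bound for the scalar curvature of a metric of constant `Q`-curvature, read off
at the minimum over a period. -/
theorem one_le_mul_cylScal_sq (hm : 0 < m) (hc : 0 < c) (hv : ∀ t, 0 < v t)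
    (h₁ : ∀ t, HasDerivAt v (v₁ t) t) (h₂ : ∀ t, HasDerivAt v₁ (v₂ t) t)
    (h₃ : ∀ t, HasDerivAt v₂ (v₃ t) t) (h₄ : ∀ t, HasDerivAt v₃ (v₄ t) t)
    (p₀ : Function.Periodic v c) (p₁ : Function.Periodic v₁ c) (p₂ : Function.Periodic v₂ c)
    (hP : ∀ t, v₄ t - (2 * m ^ 2 + 4 * m + 4) * v₂ t + m ^ 2 * (m + 2) ^ 2 * v t
      = v t ^ (1 + 4 / m)) (t : ℝ) :
    1 ≤ m * (m + 1) * (m + 3) / (m + 2) *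
      (cylScal m (v t) (v₁ t) (v₂ t) * v t ^ (-(2 / m))) ^ 2 := by
  have hpos := cylScal_pos hm hc hv h₁ h₂ h₃ h₄ p₀ p₁ p₂
    fun t => (hP t).symm ▸ Real.rpow_pos_of_pos (hv t) _
  have c₀ : Continuous v := continuous_iff_continuousAt.2 fun t => (h₁ t).continuousAt
  have c₁ : Continuous v₁ := continuous_iff_continuousAt.2 fun t => (h₂ t).continuousAt
  have c₂ : Continuous v₂ := continuous_iff_continuousAt.2 fun t => (h₃ t).continuousAt
  set S : ℝ → ℝ := fun t => cylScal m (v t) (v₁ t) (v₂ t) * v t ^ (-(2 / m)) with hS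
  have cS : Continuous S := by
    refine Continuous.mul ?_ (c₀.rpow_const fun t => Or.inl (hv t).ne')
    unfold cylScal
    refine (continuous_const.sub ((c₁.div (continuous_const.mul c₀)
      fun t => (mul_pos hm (hv t)).ne').pow 2)).sub ((c₂.div c₀ fun t => (hv t).ne').div_const m)
  have pS : Function.Periodic S c := fun t => by simp only [hS, p₀ t, p₁ t, p₂ t]
  obtain ⟨t₀, ht₀⟩ := pS.exists_forall_le hc cS
  have hle := paneitz_le_of_isLocalMin hm hv h₁ h₂ h₃ h₄ (Filter.Eventually.of_forall ht₀)
  have hv0 := hv t₀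
  rw [hP, Real.rpow_add hv0, Real.rpow_one] at hle
  have hle' : v t₀ ^ (4 / m) ≤ m * (m + 1) * (m + 3) / (m + 2) *
      cylScal m (v t₀) (v₁ t₀) (v₂ t₀) ^ 2 := by
    refine le_of_mul_le_mul_left (hle.trans_eq ?_) hv0
    ring
  have hS0 : 0 < S t₀ := mul_pos (hpos t₀) (Real.rpow_pos_of_pos hv0 _)
  have hsq : (v t₀ ^ (-(2 / m))) ^ 2 * v t₀ ^ (4 / m) = 1 := by
    rw [← Real.rpow_natCast, ← Real.rpow_mul hv0.le, ← Real.rpow_add hv0]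
    convert Real.rpow_zero (v t₀) using 2
    push_cast; ring
  calc (1 : ℝ) = (v t₀ ^ (-(2 / m))) ^ 2 * v t₀ ^ (4 / m) := hsq.symm
    _ ≤ (v t₀ ^ (-(2 / m))) ^ 2 * (m * (m + 1) * (m + 3) / (m + 2) *
      cylScal m (v t₀) (v₁ t₀) (v₂ t₀) ^ 2) := by gcongr
    _ = m * (m + 1) * (m + 3) / (m + 2) * S t₀ ^ 2 := by simp only [hS]; ring
    _ ≤ _ := by
      gcongr
      exact ht₀ t

open Filter Topology

/-! ### Calculus of radial functions -/

section Radial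

variable {n : ℕ} {x : EuclideanSpace ℝ (Fin n)}

theorem hasFDerivAt_comp_log_norm {F : ℝ → ℝ} {F' : ℝ} (hx : x ≠ 0)
    (hF : HasDerivAt F F' (Real.log ‖x‖)) :
    HasFDerivAt (fun y : EuclideanSpace ℝ (Fin n) => F (Real.log ‖y‖))
      ((F' / ‖x‖ ^ 2) • innerSL ℝ x) x := by
  have hx' : ‖x‖ ≠ 0 := norm_ne_zero_iff.2 hx
  have hlog : HasFDerivAt (fun y : EuclideanSpace ℝ (Fin n) => Real.log ‖y‖)
      ((‖x‖ ^ 2)⁻¹ • innerSL ℝ x) x := by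
    have h := (((hasStrictFDerivAt_norm_sq x).hasFDerivAt).log (pow_ne_zero 2 hx')).const_mul
      (1 / 2 : ℝ)
    have e : (fun y : EuclideanSpace ℝ (Fin n) => Real.log ‖y‖)
        = fun y => 1 / 2 * Real.log (‖y‖ ^ 2) := by
      funext y
      rw [Real.log_pow]; push_cast; ring
    rw [e]
    refine h.congr_fderiv ?_
    ext y
    simp
    ring
  refine (hF.comp_hasFDerivAt x hlog).congr_fderiv ?_
  rw [smul_smul, div_eq_mul_inv]

theorem _root_.HasFDerivAt.partialDeriv {f : EuclideanSpace ℝ (Fin n) → ℝ}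
    {f' : EuclideanSpace ℝ (Fin n) →L[ℝ] ℝ} (h : HasFDerivAt f f' x) (i : Fin n) :
    partialDeriv i f x = f' (EuclideanSpace.single i 1) := by
  rw [Delaunay.partialDeriv, h.fderiv]

theorem _root_.Filter.EventuallyEq.partialDeriv_eq {f f₁ : EuclideanSpace ℝ (Fin n) → ℝ}
    (h : f =ᶠ[𝓝 x] f₁) (i : Fin n) : partialDeriv i f x = partialDeriv i f₁ x := by
  rw [partialDeriv, h.fderiv_eq, partialDeriv]

theorem partialDeriv_comp_log_norm {F : ℝ → ℝ} {F' : ℝ} (hx : x ≠ 0)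
    (hF : HasDerivAt F F' (Real.log ‖x‖)) (i : Fin n) :
    partialDeriv i (fun y => F (Real.log ‖y‖)) x = F' / ‖x‖ ^ 2 * x i := by
  simp [(hasFDerivAt_comp_log_norm hx hF).partialDeriv, EuclideanSpace.inner_single_right]

theorem norm_gradient_comp_log_norm_sq {F : ℝ → ℝ} {F' : ℝ} (hx : x ≠ 0)
    (hF : HasDerivAt F F' (Real.log ‖x‖)) :
    ‖∇ (fun y : EuclideanSpace ℝ (Fin n) => F (Real.log ‖y‖)) x‖ ^ 2 = F' ^ 2 / ‖x‖ ^ 2 := by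
  have hx' : ‖x‖ ≠ 0 := norm_ne_zero_iff.2 hx
  rw [gradient, LinearIsometryEquiv.norm_map, (hasFDerivAt_comp_log_norm hx hF).fderiv, norm_smul,
    innerSL_apply_norm, mul_pow, Real.norm_eq_abs, sq_abs]
  field_simp

theorem sum_partialDeriv_sq_comp_log_norm {F : ℝ → ℝ} {F' : ℝ} (hx : x ≠ 0)
    (hF : HasDerivAt F F' (Real.log ‖x‖)) :
    ∑ i, partialDeriv i (fun y => F (Real.log ‖y‖)) x ^ 2 = F' ^ 2 / ‖x‖ ^ 2 := by
  have hx' : ‖x‖ ≠ 0 := norm_ne_zero_iff.2 hx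
  simp only [partialDeriv_comp_log_norm hx hF, mul_pow, ← Finset.mul_sum]
  rw [← EuclideanSpace.real_norm_sq_eq]
  field_simp

theorem sum_partialDeriv_partialDeriv_comp_log_norm {F F₁ F₂ : ℝ → ℝ} (hx : x ≠ 0)
    (h₁ : ∀ t, HasDerivAt F (F₁ t) t) (h₂ : ∀ t, HasDerivAt F₁ (F₂ t) t) :
    ∑ i, partialDeriv i (partialDeriv i (fun y => F (Real.log ‖y‖))) x
      = (F₂ (Real.log ‖x‖) + ((n : ℝ) - 2) * F₁ (Real.log ‖x‖)) / ‖x‖ ^ 2 := by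
  have hexp : ∀ y : EuclideanSpace ℝ (Fin n), y ≠ 0 →
      Real.exp (-2 * Real.log ‖y‖) = (‖y‖ ^ 2)⁻¹ := fun y hy => by
    have h := norm_pos_iff.2 hy
    rw [show -2 * Real.log ‖y‖ = -(Real.log (‖y‖ ^ 2)) by rw [Real.log_pow]; push_cast; ring,
      Real.exp_neg, Real.exp_log (by positivity)]
  have hx' : ‖x‖ ≠ 0 := norm_ne_zero_iff.2 hx
  have hG : ∀ t, HasDerivAt (fun t => F₁ t * Real.exp (-2 * t))
      ((F₂ t - 2 * F₁ t) * Real.exp (-2 * t)) t := fun t => by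
    refine ((h₂ t).mul (((hasDerivAt_id t).const_mul (-2)).exp)).congr_deriv ?_
    simp only [id]; ring
  -- The factor `|y|⁻²` in the first derivatives is absorbed as `exp (-2 log |y|)`, so that they are
  -- a function of `log |y|` times a coordinate.
  have key : ∀ i, partialDeriv i (partialDeriv i (fun y => F (Real.log ‖y‖))) x
      = (F₂ (Real.log ‖x‖) - 2 * F₁ (Real.log ‖x‖)) / ‖x‖ ^ 2 / ‖x‖ ^ 2 * x i ^ 2
        + F₁ (Real.log ‖x‖) / ‖x‖ ^ 2 := by
    intro i
    have hev : partialDeriv i (fun y : EuclideanSpace ℝ (Fin n) => F (Real.log ‖y‖)) =ᶠ[𝓝 x]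
        fun y => (F₁ (Real.log ‖y‖) * Real.exp (-2 * Real.log ‖y‖)) * y i := by
      filter_upwards [isOpen_ne.mem_nhds hx] with y hy
      rw [partialDeriv_comp_log_norm hy (h₁ _), hexp y hy, div_eq_mul_inv]
    have hd := (hasFDerivAt_comp_log_norm hx (hG (Real.log ‖x‖))).mul
      ((EuclideanSpace.proj (𝕜 := ℝ) i).hasFDerivAt (x := x))
    refine (hev.partialDeriv_eq i).trans ((hd.partialDeriv i).trans ?_)
    rw [hexp x hx]
    simp [EuclideanSpace.inner_single_right]
    field_simp
    ring
  simp only [key, Finset.sum_add_distrib, ← Finset.mul_sum]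
  rw [← EuclideanSpace.real_norm_sq_eq]
  simp
  field_simp
  ring

theorem laplacian_eq_sum_partialDeriv {f : EuclideanSpace ℝ (Fin n) → ℝ}
    (hf : ContDiffAt ℝ 2 f x) : Δ f x = ∑ i, partialDeriv i (partialDeriv i f) x := by
  have hd : DifferentiableAt ℝ (fderiv ℝ f) x :=
    (hf.fderiv_right (m := 1) (by norm_num)).differentiableAt (by norm_num)
  rw [InnerProductSpace.laplacian_eq_iteratedFDeriv_orthonormalBasis f
    (EuclideanSpace.basisFun (Fin n) ℝ)]
  refine Finset.sum_congr rfl fun i _ => ?_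
  have : partialDeriv i f = fun y => fderiv ℝ f y (EuclideanSpace.single i 1) := rfl
  rw [this, partialDeriv, fderiv_clm_apply hd (differentiableAt_const _)]
  simp [iteratedFDeriv_two_apply]

theorem contDiffAt_comp_log_norm {F : ℝ → ℝ} {k : WithTop ℕ∞} (hx : x ≠ 0) (hF : ContDiff ℝ k F) :
    ContDiffAt ℝ k (fun y : EuclideanSpace ℝ (Fin n) => F (Real.log ‖y‖)) x :=
  hF.contDiffAt.comp x ((contDiffAt_norm ℝ hx).log (norm_ne_zero_iff.2 hx))

end Radial

/-! ### The scalar curvature of a conformally flat metric -/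

section Conformal

variable {n : ℕ} {x : EuclideanSpace ℝ (Fin n)}
  {g : EuclideanSpace ℝ (Fin n) → Matrix (Fin n) (Fin n) ℝ} {φ : EuclideanSpace ℝ (Fin n) → ℝ}

theorem inv_smul_one_apply {c : ℝ} (hc : c ≠ 0) (i j : Fin n) :
    (c • (1 : Matrix (Fin n) (Fin n) ℝ))⁻¹ i j = c⁻¹ * if i = j then 1 else 0 := by
  have : (c • (1 : Matrix (Fin n) (Fin n) ℝ))⁻¹ = c⁻¹ • 1 :=
    Matrix.inv_eq_right_inv (by simp [smul_smul, hc])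
  rw [this, Matrix.smul_apply, Matrix.one_apply, smul_eq_mul]

theorem christoffel_exp_smul_one (hg : ∀ᶠ y in 𝓝 x, g y = Real.exp (2 * φ y) • 1)
    (hφ : DifferentiableAt ℝ φ x) (k i j : Fin n) :
    christoffel g k i j x = (if k = j then 1 else 0) * partialDeriv i φ x
      + (if k = i then 1 else 0) * partialDeriv j φ x
      - (if i = j then 1 else 0) * partialDeriv k φ x := by
  have hpd : ∀ a b c : Fin n, partialDeriv a (fun y => g y b c) x
      = (if b = c then 1 else 0) * (2 * Real.exp (2 * φ x) * partialDeriv a φ x) := by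
    intro a b c
    have hev : (fun y => g y b c) =ᶠ[𝓝 x]
        fun y => (if b = c then 1 else 0) * Real.exp (2 * φ y) := by
      filter_upwards [hg] with y hy
      rw [hy, Matrix.smul_apply, Matrix.one_apply, smul_eq_mul, mul_comm]
    refine (hev.partialDeriv_eq a).trans
      (((((hφ.hasFDerivAt.const_mul 2).exp).const_mul
        (if b = c then (1 : ℝ) else 0)).partialDeriv a).trans ?_)
    simp only [partialDeriv, smul_apply, smul_eq_mul]
    ring
  have hE := Real.exp_ne_zero (2 * φ x)
  have hsum : ∀ X : Fin n → ℝ, ∑ l, (Real.exp (2 * φ x))⁻¹ * (if k = l then 1 else 0) * X l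
      = (Real.exp (2 * φ x))⁻¹ * X k := fun X => by simp
  simp only [christoffel, hpd, hg.self_of_nhds, inv_smul_one_apply hE, hsum]
  simp only [eq_comm (a := j) (b := k), eq_comm (a := i) (b := k)]
  field_simp

/-- The scalar curvature of the metric `exp (2 φ) |dx|²`. -/
theorem scalarCurvature_exp_smul_one (hg : ∀ᶠ y in 𝓝 x, g y = Real.exp (2 * φ y) • 1)
    (hφ : ContDiffAt ℝ 2 φ x) :
    scalarCurvature g x = -(Real.exp (2 * φ x))⁻¹ *
      (2 * ((n : ℝ) - 1) * ∑ i, partialDeriv i (partialDeriv i φ) x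
        + ((n : ℝ) - 1) * ((n : ℝ) - 2) * ∑ i, partialDeriv i φ x ^ 2) := by
  have hE := Real.exp_ne_zero (2 * φ x)
  have hd : ∀ i, DifferentiableAt ℝ (partialDeriv i φ) x := fun i =>
    ((hφ.fderiv_right (m := 1) (by norm_num)).differentiableAt (by norm_num)).clm_apply
      (differentiableAt_const _)
  have hev : ∀ k i j, christoffel g k i j =ᶠ[𝓝 x] fun y =>
      (if k = j then 1 else 0) * partialDeriv i φ y
      + (if k = i then 1 else 0) * partialDeriv j φ y
      - (if i = j then 1 else 0) * partialDeriv k φ y := fun k i j => by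
    filter_upwards [hg.eventually_nhds, hφ.eventually (by simp)] with y hy hy'
    exact christoffel_exp_smul_one hy (hy'.differentiableAt (by norm_num)) k i j
  have hpd : ∀ l k i j, partialDeriv l (christoffel g k i j) x =
      (if k = j then 1 else 0) * partialDeriv l (partialDeriv i φ) x
      + (if k = i then 1 else 0) * partialDeriv l (partialDeriv j φ) x
      - (if i = j then 1 else 0) * partialDeriv l (partialDeriv k φ) x := fun l k i j => by
    refine ((hev k i j).partialDeriv_eq l).trans
      ((((((hd i).hasFDerivAt.const_mul (if k = j then (1 : ℝ) else 0)).add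
        ((hd j).hasFDerivAt.const_mul (if k = i then (1 : ℝ) else 0))).sub
        ((hd k).hasFDerivAt.const_mul (if i = j then (1 : ℝ) else 0))).partialDeriv l).trans ?_)
    simp only [partialDeriv, add_apply, sub_apply, smul_apply, smul_eq_mul]
  have hval : ∀ k i j, christoffel g k i j x = _ := fun k i j => (hev k i j).self_of_nhds
  have hR : scalarCurvature g x = (Real.exp (2 * φ x))⁻¹ * ∑ i, ricci g i i x := by
    simp only [scalarCurvature, hg.self_of_nhds, inv_smul_one_apply hE, mul_assoc,
      ← Finset.mul_sum, ite_mul, one_mul, zero_mul, Finset.sum_ite_eq, Finset.mem_univ, if_true]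
  have hT : ∑ i, ricci g i i x = -(2 * ((n : ℝ) - 1) * ∑ i, partialDeriv i (partialDeriv i φ) x
        + ((n : ℝ) - 1) * ((n : ℝ) - 2) * ∑ i, partialDeriv i φ x ^ 2) := by
    simp only [ricci, hpd, hval]
    generalize hA : (fun i j => partialDeriv i (partialDeriv j φ) x) = A
    generalize hb : (fun i => partialDeriv i φ x) = b
    have hA' : ∀ i j, partialDeriv i (partialDeriv j φ) x = A i j := fun i j => by rw [← hA]
    have hb' : ∀ i, partialDeriv i φ x = b i := fun i => by rw [← hb]
    simp only [hA', hb']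
    simp [Finset.sum_add_distrib, Finset.sum_sub_distrib, mul_add, add_mul, mul_sub, sub_mul,
      Finset.mul_sum]
    simp only [pow_two, mul_assoc, ← Finset.mul_sum]
    ring
  rw [hR, hT]
  ring

end Conformal

/-! ### The singular solution in the logarithmic variable -/

section Solution

variable {n : ℕ} {m : ℝ} {v v₁ v₂ : ℝ → ℝ} {x : EuclideanSpace ℝ (Fin n)}

theorem singularSolution_eq_exp_mul (hn : (n : ℝ) = 2 * m + 4) (hx : x ≠ 0) :
    singularSolution n v x = Real.exp (-m * Real.log ‖x‖) * v (Real.log ‖x‖) := by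
  rw [singularSolution, Real.rpow_def_of_pos (norm_pos_iff.2 hx), hn]
  congr 2
  ring

/-- The difference of the two sides of the inequality is a positive multiple of the scalar curvature
minus its sharp lower bound. -/
theorem neg_laplacian_sub_eq (hn : (n : ℝ) = 2 * m + 4) (hm : 0 < m) (hv : ∀ t, 0 < v t)
    (hC : ContDiff ℝ 2 v)
    (h₁ : ∀ t, HasDerivAt v (v₁ t) t) (h₂ : ∀ t, HasDerivAt v₁ (v₂ t) t) (hx : x ≠ 0) :
    -(Δ (singularSolution n v) x)
        - m⁻¹ * (‖∇ (singularSolution n v) x‖ ^ 2 / singularSolution n v x)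
      = m * cylScal m (v (Real.log ‖x‖)) (v₁ (Real.log ‖x‖)) (v₂ (Real.log ‖x‖))
        * v (Real.log ‖x‖) ^ (-(2 / m))
        * singularSolution n v x ^ ((n : ℝ) / ((n : ℝ) - 4)) := by
  set F : ℝ → ℝ := fun t => Real.exp (-m * t) * v t with hF
  have hev : singularSolution n v =ᶠ[𝓝 x] fun y => F (Real.log ‖y‖) := by
    filter_upwards [isOpen_ne.mem_nhds hx] with y hy using singularSolution_eq_exp_mul hn hy
  have hFC : ContDiff ℝ 2 F := (contDiff_const.mul contDiff_id).exp.mul hC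
  have de : ∀ t, HasDerivAt (fun t => Real.exp (-m * t)) (-m * Real.exp (-m * t)) t := fun t =>
    (((hasDerivAt_id t).const_mul (-m)).exp).congr_deriv (by simp only [id]; ring)
  have dF : ∀ t, HasDerivAt F (Real.exp (-m * t) * (v₁ t - m * v t)) t := fun t =>
    ((de t).mul (h₁ t)).congr_deriv (by ring)
  have dF1 : ∀ t, HasDerivAt (fun t => Real.exp (-m * t) * (v₁ t - m * v t))
      (Real.exp (-m * t) * (v₂ t - 2 * m * v₁ t + m ^ 2 * v t)) t := fun t =>
    ((de t).mul ((h₂ t).sub ((h₁ t).const_mul m))).congr_deriv (by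
      simp only [Pi.sub_apply]; ring)
  have hg : ‖∇ (singularSolution n v) x‖ ^ 2 = _ :=
    (congrArg (fun L => ‖(InnerProductSpace.toDual ℝ _).symm L‖ ^ 2) hev.fderiv_eq).trans
      (norm_gradient_comp_log_norm_sq hx (dF _))
  have hL : Δ (singularSolution n v) x = _ :=
    (InnerProductSpace.laplacian_congr_nhds hev).eq_of_nhds.trans
      ((laplacian_eq_sum_partialDeriv (contDiffAt_comp_log_norm hx hFC)).trans
        (sum_partialDeriv_partialDeriv_comp_log_norm hx dF dF1))
  rw [hg, hL, singularSolution_eq_exp_mul hn hx]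
  have hr := norm_pos_iff.2 hx
  set t := Real.log ‖x‖ with ht
  have hvt := hv t
  have hnorm : ‖x‖ ^ 2 = Real.exp (2 * t) := by
    rw [two_mul, Real.exp_add, ht, Real.exp_log hr, pow_two]
  have hpow : (Real.exp (-m * t) * v t) ^ ((n : ℝ) / ((n : ℝ) - 4))
      = Real.exp (-m * t) * (Real.exp (2 * t))⁻¹ * (v t * (v t ^ (-(2 / m)))⁻¹) := by
    have hq : (n : ℝ) / ((n : ℝ) - 4) = 1 + 2 / m := by rw [hn]; field_simp; ring
    rw [hq, Real.mul_rpow (Real.exp_pos _).le hvt.le, Real.rpow_add hvt, Real.rpow_one,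
      Real.rpow_neg hvt.le, inv_inv, ← Real.exp_mul, ← Real.exp_neg, ← Real.exp_add]
    congr 2
    field_simp
    ring
  have h1 := Real.exp_pos (-m * t)
  have h2 := Real.exp_pos (2 * t)
  have h3 := Real.rpow_pos_of_pos hvt (-(2 / m))
  rw [hpow, hnorm, hn, cylScal]
  field_simp
  ring

/-- The metric is `exp (2 φ) |dx|²` with `φ = log v / m - t` and `t = log |x|`. -/
theorem scalarCurvature_conformalMetric (hn : (n : ℝ) = 2 * m + 4) (hm : 0 < m) (hv : ∀ t, 0 < v t)
    (hC : ContDiff ℝ 2 v)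
    (h₁ : ∀ t, HasDerivAt v (v₁ t) t) (h₂ : ∀ t, HasDerivAt v₁ (v₂ t) t) (hx : x ≠ 0) :
    scalarCurvature (conformalMetric (singularSolution n v)) x
      = 2 * ((n : ℝ) - 1) * v (Real.log ‖x‖) ^ (-(2 / m))
        * cylScal m (v (Real.log ‖x‖)) (v₁ (Real.log ‖x‖)) (v₂ (Real.log ‖x‖)) := by
  set F : ℝ → ℝ := fun t => Real.log (v t) / m - t with hF
  have hFC : ContDiff ℝ 2 F := ((hC.log fun t => (hv t).ne').div_const m).sub contDiff_id
  have hev : ∀ᶠ y in 𝓝 x, conformalMetric (singularSolution n v) y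
      = Real.exp (2 * F (Real.log ‖y‖)) • 1 := by
    filter_upwards [isOpen_ne.mem_nhds hx] with y hy
    rw [conformalMetric, singularSolution_eq_exp_mul hn hy,
      Real.mul_rpow (Real.exp_pos _).le (hv _).le, Real.rpow_def_of_pos (hv _), ← Real.exp_mul,
      ← Real.exp_add, hn]
    congr 2
    simp only [hF]
    field_simp
    ring
  have dF : ∀ t, HasDerivAt F (v₁ t / (m * v t) - 1) t := fun t =>
    ((((h₁ t).log (hv t).ne').div_const m).sub (hasDerivAt_id t)).congr_deriv (by
      have := (hv t).ne'
      field_simp)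
  have dF1 : ∀ t, HasDerivAt (fun t => v₁ t / (m * v t) - 1)
      (v₂ t / v t / m - m * (v₁ t / (m * v t)) ^ 2) t := fun t =>
    (((h₂ t).div ((h₁ t).const_mul m) (mul_pos hm (hv t)).ne').sub_const 1).congr_deriv (by
      have := (hv t).ne'
      field_simp)
  rw [scalarCurvature_exp_smul_one hev (contDiffAt_comp_log_norm hx hFC),
    sum_partialDeriv_partialDeriv_comp_log_norm hx dF dF1,
    sum_partialDeriv_sq_comp_log_norm hx (dF _)]
  have hr := norm_pos_iff.2 hx
  set t := Real.log ‖x‖ with ht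
  have hvt := hv t
  have hnorm : ‖x‖ ^ 2 = Real.exp (2 * t) := by
    rw [two_mul, Real.exp_add, ht, Real.exp_log hr, pow_two]
  have hexp : (Real.exp (2 * F t))⁻¹ = v t ^ (-(2 / m)) * Real.exp (2 * t) := by
    rw [Real.rpow_def_of_pos hvt, ← Real.exp_add, ← Real.exp_neg]
    congr 1
    simp only [hF]
    field_simp
    ring
  have h2 := Real.exp_pos (2 * t)
  rw [hexp, hnorm, hn, cylScal]
  field_simp
  ring

end Solution

end Delaunay

theorem theorem1p3 (n : ℕ) (hn : 5 ≤ n) (T : ℝ) (hT : 0 < T) (v : ℝ → ℝ)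
    (hv : Delaunay.IsPositivePeriodicSolution n T v) :
    (∀ x : EuclideanSpace ℝ (Fin n), x ≠ 0 →
      Real.sqrt ((n : ℝ) * ((n : ℝ) - 4) / ((n : ℝ) ^ 2 - 4))
            * Delaunay.singularSolution n v x ^ ((n : ℝ) / ((n : ℝ) - 4))
          + 2 / ((n : ℝ) - 4) * (‖∇ (Delaunay.singularSolution n v) x‖ ^ 2
            / Delaunay.singularSolution n v x)
        ≤ -(Δ (Delaunay.singularSolution n v) x)) ∧
    (∀ x : EuclideanSpace ℝ (Fin n), x ≠ 0 →
      0 < Delaunay.scalarCurvature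
        (Delaunay.conformalMetric (Delaunay.singularSolution n v)) x) := by
  obtain ⟨m, hnm⟩ : ∃ m : ℝ, (n : ℝ) = 2 * m + 4 := ⟨((n : ℝ) - 4) / 2, by ring⟩
  have hm : 0 < m := by
    have : (5 : ℝ) ≤ n := by exact_mod_cast hn
    linarith
  have hD : ∀ k < 4, ∀ t, HasDerivAt (iteratedDeriv k v) (iteratedDeriv (k + 1) v t) t := by
    intro k hk t
    rw [iteratedDeriv_succ]
    exact (hv.contDiff.differentiable_iteratedDeriv k (by exact_mod_cast hk) t).hasDerivAt
  have h₁ : ∀ t, HasDerivAt v (iteratedDeriv 1 v t) t := by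
    simpa only [iteratedDeriv_zero] using hD 0 (by norm_num)
  have h₂ : ∀ t, HasDerivAt (iteratedDeriv 1 v) (iteratedDeriv 2 v t) t := hD 1 (by norm_num)
  have h₃ : ∀ t, HasDerivAt (iteratedDeriv 2 v) (iteratedDeriv 3 v t) t := hD 2 (by norm_num)
  have h₄ : ∀ t, HasDerivAt (iteratedDeriv 3 v) (iteratedDeriv 4 v t) t := hD 3 (by norm_num)
  have hper : ∀ k, Function.Periodic (iteratedDeriv k v) (2 * T) := fun k t => by
    have h := congrFun (iteratedDeriv_comp_add_const k v (2 * T)) t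
    rw [show (fun z => v (z + 2 * T)) = v from funext hv.periodic] at h
    exact h.symm
  have hP : ∀ t, iteratedDeriv 4 v t - (2 * m ^ 2 + 4 * m + 4) * iteratedDeriv 2 v t
      + m ^ 2 * (m + 2) ^ 2 * v t = v t ^ (1 + 4 / m) := fun t => by
    have h := hv.equation t
    have hp : ((n : ℝ) + 4) / ((n : ℝ) - 4) = 1 + 4 / m := by rw [hnm]; field_simp; ring
    rw [hp, Delaunay.K₂, Delaunay.K₀, hnm] at h
    rw [← h]
    ring
  have hT2 : 0 < 2 * T := by positivity
  have hpos := Delaunay.cylScal_pos hm hT2 hv.pos h₁ h₂ h₃ h₄ hv.periodic (hper 1) (hper 2)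
    fun t => (hP t).symm ▸ Real.rpow_pos_of_pos (hv.pos t) _
  have hC : ContDiff ℝ 2 v := hv.contDiff.of_le (by norm_num)
  refine ⟨fun x hx => ?_, fun x hx => ?_⟩
  · have hkey := Delaunay.neg_laplacian_sub_eq hnm hm hv.pos hC h₁ h₂ hx
    have hS := Delaunay.one_le_mul_cylScal_sq hm hT2 hv.pos h₁ h₂ h₃ h₄ hv.periodic (hper 1)
      (hper 2) hP (Real.log ‖x‖)
    have hs := hpos (Real.log ‖x‖)
    set t := Real.log ‖x‖
    have hw := Real.rpow_pos_of_pos (hv.pos t) (-(2 / m))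
    have hc : Real.sqrt ((n : ℝ) * ((n : ℝ) - 4) / ((n : ℝ) ^ 2 - 4))
        ≤ m * Delaunay.cylScal m (v t) (iteratedDeriv 1 v t) (iteratedDeriv 2 v t)
          * v t ^ (-(2 / m)) := by
      refine Real.sqrt_le_iff.2 ⟨by positivity, ?_⟩
      have e : (n : ℝ) * ((n : ℝ) - 4) / ((n : ℝ) ^ 2 - 4)
          = m * (m + 2) / ((m + 1) * (m + 3)) := by
        rw [hnm, show (2 * m + 4) ^ 2 - 4 = 4 * ((m + 1) * (m + 3)) by ring]
        field_simp
        ring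
      rw [e, div_le_iff₀ (by positivity)]
      calc m * (m + 2) = m * (m + 2) * 1 := (mul_one _).symm
        _ ≤ m * (m + 2) * _ := mul_le_mul_of_nonneg_left hS (by positivity)
        _ = _ := by field_simp
    have hu : 0 ≤ Delaunay.singularSolution n v x ^ ((n : ℝ) / ((n : ℝ) - 4)) := by
      rw [Delaunay.singularSolution_eq_exp_mul hnm hx]
      exact Real.rpow_nonneg (mul_pos (Real.exp_pos _) (hv.pos _)).le _
    have := mul_le_mul_of_nonneg_right hc hu
    have e2 : 2 / ((n : ℝ) - 4) = m⁻¹ := by rw [hnm]; field_simp; ring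
    rw [e2]
    linarith
  · rw [Delaunay.scalarCurvature_conformalMetric hnm hm hv.pos hC h₁ h₂ hx]
    have hw := Real.rpow_pos_of_pos (hv.pos (Real.log ‖x‖)) (-(2 / m))
    have : 0 < 2 * ((n : ℝ) - 1) := by rw [hnm]; linarith
    exact mul_pos (mul_pos this hw) (hpos _)
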